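/- **Proposition (training-time augmentation bound on the induced augmentation distribution).** *Encoders.* Fix a depth $L$ and layer widths $n_0,\dots,n_L$, and put $d=n_L$. For weights $\theta=(W_1,\dots,W_L)$ with $W_\ell\in\mathbb R^{n_\ell\times n_{\ell-1}}$ let $\Phi_\theta(q)=a_L(q)$, where $a_0(q)=q$ and $a_\ell(q)=\psi_\ell(W_\ell a_{\ell-1}(q))$; each nonlinearity $\psi_\ell:\mathbb R^{n_\ell}\to\mathbb R^{n_\ell}$ is $1$-Lipschitz for the Euclidean norm and satisfies $\psi_\ell(0)=0$. Let $\Theta$ be any set of weights with spectral norms $\|W_\ell\|_2\le s_\ell$ for all $\theta\in\Theta$ and all $\ell$, where $\prod_{\ell=1}^L s_\ell\le L_{\mathrm{enc}}$. Let $\mathcal X\subseteq\mathbb R^{n_0}$ be a bounded set, and $B_X:=\sup_{q\in\mathcal X}\|q\|_2$. For a pair $x=(q,p)\in\mathcal X\times\mathbb R^d$ (the prototype $p$ does not depend on $\theta$) and a fixed threshold $\beta\in\mathbb R$ put $$\Omega_\theta(x)=\Phi_\theta(q)-p,\qquad g_\theta(x)=\beta-\|\Omega_\theta(x)\|_2^2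 .$$ *Data.* Let $P_{\mathrm{base}}$ be a probability distribution of $(x,y)\in(\mathcal X\times\mathbb R^d)\times\{-1,1\}$, let $m_{\mathrm{base}}\ge1$ and $M_{\mathrm{tr}}\ge0$ be integers, let $A_1,\dots,A_{M_{\mathrm{tr}}}$ be (possibly random) augmentations of pairs, and let $A_0$ be the identity. Let $P^{\mathrm{aug}}$ be the induced augmentation distribution: the law of $(A_k(x),y)$ for $(x,y)\sim P_{\mathrm{base}}$ and an independent $k$ uniform on $\{0,\dots,M_{\mathrm{tr}}\}$. Put $m:=m_{\mathrm{base}}(M_{\mathrm{tr}}+1)$, and let the augmented sample $S=\{(x_i^{(k)},y_i^{(k)})\}_{1\le i\le m_{\mathrm{base}},\,0\le k\le M_{\mathrm{tr}}}$ consist of $m$ i.i.d. draws from $P^{\mathrm{aug}}$. Suppose that, almost surely, $\|\Omega_\theta(x_i^{(k)})\|_2\le r$ for all $i$, $k$ and all $\theta\in\Theta$. *Risks.* Let $\tau_\rho(t)=1$ for $t\le0$, $\tau_\rho(t)=1-t/\rho$ for $0<t<\rho$, $\tau_\rho(t)=0$ for $t\ge\rho$, and $$R^{\mathrm{aug}}(\theta)=\mathbb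 P_{(x,y)\sim P^{\mathrm{aug}}}\bigl(y\,g_\theta(x)\le0\bigr),\qquad \widehat R_{S,\rho}(\theta)=\frac1m\sum_{i,k}\tau_\rho\bigl(y_i^{(k)}g_\theta(x_i^{(k)})\bigr).$$ *Claim.* There is a constant $C_{\mathrm{enc}}>0$, depending only on the architecture $(L;n_0,\dots,n_L)$, such that in every such situation, for all $\rho>0$ and $\delta>0$ (for $\delta\ge1$ the claim is void), with probability at least $1-\delta$ over the draw of $S$, every $\theta\in\Theta$ satisfies $$R^{\mathrm{aug}}(\theta)\;\le\;\widehat R_{S,\rho}(\theta)+\frac{2\,C_{\mathrm{enc}}\,B_X\,L_{\mathrm{enc}}}{\rho}\cdot\frac{r}{\sqrt{m_{\mathrm{base}}(M_{\mathrm{tr}}+1)}}+\sqrt{\frac{\log(1/\delta)}{2\,m_{\mathrm{base}}(M_{\mathrm{tr}}+1)}} .$$ -/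

import Mathlib

open MeasureTheory ProbabilityTheory

/-- Real Euclidean space of dimension `d`, with the `ℓ²` norm. -/
abbrev Euc (d : ℕ) : Type := EuclideanSpace ℝ (Fin d)

/-- The labels `-1` and `1`, as real numbers. -/
abbrev Label : Type := ({-1, 1} : Set ℝ)

/-- Weights of a feedforward network with layer widths `n 0, …, n L`. The weight matrix of a layer
is given as a linear map between Euclidean spaces, so that its norm `‖W ℓ‖` is the spectral norm. -/
abbrev NetWeights {L : ℕ} (n : Fin (L + 1) → ℕ) : Type :=
  ∀ ℓ : Fin L, Euc (n ℓ.castSucc) →L[ℝ] Euc (n ℓ.succ)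

/-- Nonlinearities of the layers; they need not act coordinatewise. -/
abbrev NetNonlin {L : ℕ} (n : Fin (L + 1) → ℕ) : Type :=
  ∀ ℓ : Fin L, Euc (n ℓ.succ) → Euc (n ℓ.succ)

noncomputable section

/-- Hidden states of the network: `a₀ = q` and `a_{ℓ+1} = ψ_ℓ (W_ℓ a_ℓ)`. -/
def hiddenState {L : ℕ} {n : Fin (L + 1) → ℕ} (ψ : NetNonlin n) (W : NetWeights n)
    (q : Euc (n 0)) : ∀ ℓ : Fin (L + 1), Euc (n ℓ) :=
  Fin.induction q (fun ℓ a => ψ ℓ (W ℓ a))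

/-- The encoder `Φ_θ`: the output of the last layer of the network with weights `θ`. -/
def encoder {L : ℕ} {n : Fin (L + 1) → ℕ} (ψ : NetNonlin n) (θ : NetWeights n)
    (q : Euc (n 0)) : Euc (n (Fin.last L)) :=
  hiddenState ψ θ q (Fin.last L)

/-- The query–prototype pairs `x = (q, p)` with `q` in the input domain. -/
abbrev QPair {L : ℕ} (n : Fin (L + 1) → ℕ) (𝒳 : Set (Euc (n 0))) : Type :=
  𝒳 × Euc (n (Fin.last L))

/-- The difference feature `Ω_θ(q, p) = Φ_θ(q) - p`. -/
def diffFeature {L : ℕ} {n : Fin (L + 1) → ℕ} {𝒳 : Set (Euc (n 0))} (ψ : NetNonlin n)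
    (θ : NetWeights n) (x : QPair n 𝒳) : Euc (n (Fin.last L)) :=
  encoder ψ θ (x.1 : Euc (n 0)) - x.2

/-- The shifted Euclidean score `g_θ(x) = β - ‖Ω_θ(x)‖²`. -/
def score {L : ℕ} {n : Fin (L + 1) → ℕ} {𝒳 : Set (Euc (n 0))} (ψ : NetNonlin n) (β : ℝ)
    (θ : NetWeights n) (x : QPair n 𝒳) : ℝ :=
  β - ‖diffFeature ψ θ x‖ ^ 2

/-- The piecewise linear `ρ`-margin loss. -/
def marginLoss (ρ t : ℝ) : ℝ :=
  if t ≤ 0 then 1 else if t < ρ then 1 - t / ρ else 0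

/-- `B_X`, the supremum of `‖q‖` over the input domain. -/
def inputRadius {d : ℕ} (𝒳 : Set (Euc d)) : ℝ :=
  ⨆ q : 𝒳, ‖(q : Euc d)‖

/-- The `M + 1` views of an input: view `0` is the input itself, view `k ≥ 1` is the `k`-th
augmentation. An augmentation is a Markov kernel, hence may be random; a deterministic
augmentation map is the case of `Kernel.deterministic`. -/
def augView {X : Type*} [MeasurableSpace X] {M : ℕ} (A : Fin M → Kernel X X) :
    Fin (M + 1) → Kernel X X :=
  Fin.cases Kernel.id A

/-- The augmentation distribution induced by a distribution `P` of labelled inputs: draw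
`(x, y)` from `P`, choose one of the `M + 1` views uniformly, and return that view of `x` together
with the unchanged label `y`. -/
def trainAugLaw {X Y : Type*} [MeasurableSpace X] [MeasurableSpace Y] {M : ℕ}
    (P : Measure (X × Y)) (A : Fin M → Kernel X X) : Measure (X × Y) :=
  ((M : ENNReal) + 1)⁻¹ • ∑ k : Fin (M + 1), (augView A k ∥ₖ Kernel.id) ∘ₘ P

/-- The `0`-`1` pairwise risk `ℙ (y g_θ(x) ≤ 0)` for `(x, y)` distributed as `P`. -/
def clsRisk {L : ℕ} {n : Fin (L + 1) → ℕ} {𝒳 : Set (Euc (n 0))} (ψ : NetNonlin n) (β : ℝ)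
    (P : Measure (QPair n 𝒳 × Label)) (θ : NetWeights n) : ℝ :=
  P.real {z | (z.2 : ℝ) * score ψ β θ z.1 ≤ 0}

/-- The empirical `ρ`-margin risk on a finite sample `S`. -/
def empMarginRisk {L : ℕ} {n : Fin (L + 1) → ℕ} {𝒳 : Set (Euc (n 0))} {ι : Type*} [Fintype ι]
    (ψ : NetNonlin n) (β ρ : ℝ) (S : ι → QPair n 𝒳 × Label) (θ : NetWeights n) : ℝ :=
  (1 / (Fintype.card ι : ℝ)) *
    ∑ j : ι, marginLoss ρ (((S j).2 : ℝ) * score ψ β θ (S j).1)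

/-- The law of the augmented training sample: `m (M + 1)` independent draws from the induced
augmentation distribution, indexed by the base example `i` and the view `k`. -/
def trainAugSampleLaw {X Y : Type*} [MeasurableSpace X] [MeasurableSpace Y] {M : ℕ} (m : ℕ)
    (P : Measure (X × Y)) (A : Fin M → Kernel X X) :
    Measure (Fin m × Fin (M + 1) → X × Y) :=
  Measure.pi (fun _ => trainAugLaw P A)

end

/-!
The margin risk `𝔼 τ_ρ(y g_θ)` dominates the `0`-`1` risk, so it is enough to bound, uniformly in
`θ`, the gap between the expectation and the empirical mean of the margin losses. No Rademacher
complexity is needed: after division of each layer by its norm bound `s ℓ`, the weights range over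
a subset of the unit ball of a normed space of dimension `D`, fixed by the architecture, and the
loss is Lipschitz in the normalised weights with constant `K = 2 r / ρ * (L + 1) * L_enc * B_X`.
This combines the Lipschitz dependence of the encoder on its weights (`norm_encoder_sub_le`) with
the fact that `‖Ω‖ ^ 2` is `2 r`-Lipschitz where `‖Ω‖ ≤ r` (`abs_marginLoss_score_sub_le`).

The gap is thus a centred process with sub-Gaussian increments of size `K ‖θ - θ'‖ / √N`, where
`N` is the sample size. Chaining over nets whose cardinality is bounded by a volume comparison
(`exists_finset_net`) bounds its expected maximum by `12 (3 D + 1) K / √N`, without a logarithm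
(`integral_sup_empiricalGap_le`). McDiarmid's inequality (`hasSubgaussianMGF_pi`) gives the
confidence term with its sharp constant, for the increments as well as for the maximum over a
finite set of weights. An increasing sequence of finite nets then covers all of `Θ` by continuity
(`measurableSet_and_le_measureReal_forall_empiricalGap_le`).

The bound `‖Ω‖ ≤ r` holds only almost surely, so the losses are set to zero off the closed set where
it holds for every `θ ∈ Θ`; that set carries the augmentation distribution.
-/

/-! ### Separated sets and nets in a finite-dimensional unit ball -/

/-- Volume bound: the balls of radius `ε / 2` around the points of an `ε`-separated subset of the
unit ball are disjoint and contained in the ball of radius `1 + ε / 2`. -/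
theorem card_le_of_separated_of_norm_le_one {E : Type*} [NormedAddCommGroup E] [NormedSpace ℝ E]
    [FiniteDimensional ℝ E] {ε : ℝ} (hε : 0 < ε) (s : Finset E) (hs : ∀ c ∈ s, ‖c‖ ≤ 1)
    (h : ∀ c ∈ s, ∀ d ∈ s, c ≠ d → ε ≤ ‖c - d‖) :
    (s.card : ℝ) ≤ (1 + 2 / ε) ^ Module.finrank ℝ E := by
  borelize E
  let μ : Measure E := Measure.addHaar
  have hε2 : 0 < ε / 2 := by positivity
  have hρ : 0 < 1 + ε / 2 := by positivity
  have D : (s : Set E).Pairwise (Function.onFun Disjoint fun c => Metric.ball c (ε / 2)) := by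
    intro c hc d hd hcd
    apply Metric.ball_disjoint_ball
    rw [dist_eq_norm]
    linarith [h c hc d hd hcd]
  have hsub : (⋃ c ∈ s, Metric.ball c (ε / 2)) ⊆ Metric.ball (0 : E) (1 + ε / 2) := by
    refine Set.iUnion₂_subset fun x hx => Metric.ball_subset_ball' ?_
    rw [dist_zero_right]
    linarith [hs x hx]
  have I : (s.card : ENNReal) * ENNReal.ofReal ((ε / 2) ^ Module.finrank ℝ E)
      * μ (Metric.ball 0 1) ≤
      ENNReal.ofReal ((1 + ε / 2) ^ Module.finrank ℝ E) * μ (Metric.ball 0 1) := by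
    calc
      _ = μ (⋃ c ∈ s, Metric.ball c (ε / 2)) := by
        rw [measure_biUnion_finset D fun c _ => measurableSet_ball]
        simp only [μ.addHaar_ball_of_pos _ hε2, Finset.sum_const, nsmul_eq_mul, mul_assoc]
      _ ≤ μ (Metric.ball (0 : E) (1 + ε / 2)) := measure_mono hsub
      _ = _ := by rw [μ.addHaar_ball_of_pos _ hρ]
  have J : (s.card : ENNReal) * ENNReal.ofReal ((ε / 2) ^ Module.finrank ℝ E) ≤
      ENNReal.ofReal ((1 + ε / 2) ^ Module.finrank ℝ E) :=
    (ENNReal.mul_le_mul_iff_left (Metric.measure_ball_pos _ _ zero_lt_one).ne'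
      measure_ball_lt_top.ne).1 I
  have K := ENNReal.toReal_le_of_le_ofReal (pow_nonneg hρ.le _) J
  rw [ENNReal.toReal_mul, ENNReal.toReal_natCast,
    ENNReal.toReal_ofReal (pow_nonneg hε2.le _)] at K
  have hfac : 1 + 2 / ε = (1 + ε / 2) / (ε / 2) := by field_simp; ring
  rw [hfac, div_pow, le_div_iff₀ (by positivity)]
  exact K

/-- A family in the unit ball has an internal `ε`-net of cardinality at most `(1 + 2 / ε) ^ dim`. -/
theorem exists_finset_net {I E : Type*} [NormedAddCommGroup E] [NormedSpace ℝ E]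
    [FiniteDimensional ℝ E] (e : I → E) (he : ∀ i, ‖e i‖ ≤ 1) {ε : ℝ} (hε : 0 < ε) :
    ∃ s : Finset I, (s.card : ℝ) ≤ (1 + 2 / ε) ^ Module.finrank ℝ E ∧
      ∀ i, ∃ j ∈ s, ‖e i - e j‖ ≤ ε := by
  classical
  let Sep : Finset I → Prop := fun s => ∀ i ∈ s, ∀ j ∈ s, i ≠ j → ε ≤ ‖e i - e j‖
  have hcard : ∀ s, Sep s → (s.card : ℝ) ≤ (1 + 2 / ε) ^ Module.finrank ℝ E := by
    intro s hs
    have hinj : Set.InjOn e s := by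
      intro i hi j hj hij
      by_contra hne
      have := hs i hi j hj hne
      rw [hij, sub_self, norm_zero] at this
      linarith
    rw [← Finset.card_image_of_injOn hinj]
    refine card_le_of_separated_of_norm_le_one hε _ ?_ ?_
    · intro c hc
      obtain ⟨i, -, rfl⟩ := Finset.mem_image.1 hc
      exact he i
    · intro c hc d hd hcd
      obtain ⟨i, hi, rfl⟩ := Finset.mem_image.1 hc
      obtain ⟨j, hj, rfl⟩ := Finset.mem_image.1 hd
      exact hs i hi j hj fun h => hcd (by rw [h])
  -- A separated set of maximal cardinality is a net.
  let p : ℕ → Prop := fun k => ∃ s, Sep s ∧ s.card = k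
  obtain ⟨B, hB⟩ := exists_nat_ge ((1 + 2 / ε) ^ Module.finrank ℝ E)
  have hp0 : p 0 := ⟨∅, by simp [Sep], rfl⟩
  obtain ⟨s, hs, hsc⟩ := Nat.findGreatest_spec (P := p) (Nat.zero_le B) hp0
  refine ⟨s, hcard s hs, fun i => ?_⟩
  by_contra! hfar
  have his : i ∉ s := fun hi => by
    have := hfar i hi
    rw [sub_self, norm_zero] at this
    linarith
  have hins : Sep (insert i s) := by
    intro a ha b hb hab
    rcases Finset.mem_insert.1 ha with rfl | ha' <;> rcases Finset.mem_insert.1 hb with rfl | hb'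
    · exact absurd rfl hab
    · exact (hfar b hb').le
    · rw [norm_sub_rev]; exact (hfar a ha').le
    · exact hs a ha' b hb' hab
  have hle : (insert i s).card ≤ B := by exact_mod_cast (hcard _ hins).trans hB
  have := Nat.le_findGreatest (P := p) hle ⟨_, hins, rfl⟩
  rw [Finset.card_insert_of_notMem his] at this
  omega

/-! ### McDiarmid's inequality -/

/-- A measurable function of `n` independent variables that changes by at most `c` when one of them
is changed is sub-Gaussian. Integrating out the first coordinate leaves a function of the others
with the same property, and Hoeffding's lemma controls the conditional fluctuation. -/
theorem hasSubgaussianMGF_pi_fin {Z : Type*} [MeasurableSpace Z] (μ : Measure Z)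
    [IsProbabilityMeasure μ] (c : NNReal) (B : ℝ) (n : ℕ) :
    ∀ f : (Fin n → Z) → ℝ, Measurable f → (∀ x, |f x| ≤ B) →
      (∀ x i z, |f (Function.update x i z) - f x| ≤ c) →
      HasSubgaussianMGF (fun x => f x - ∫ x, f x ∂(Measure.pi fun _ => μ))
        (n * (c / 2) ^ 2) (Measure.pi fun _ => μ) := by
  have hint : ∀ {Ω : Type _} [MeasurableSpace Ω] (ν : Measure Ω) [IsProbabilityMeasure ν]
      (h : Ω → ℝ), Measurable h → (∀ x, |h x| ≤ B) → Integrable h ν := fun ν _ h hm hb =>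
    Integrable.of_bound hm.aestronglyMeasurable B (Filter.Eventually.of_forall hb)
  have hexp : ∀ {Ω : Type _} [MeasurableSpace Ω] (ν : Measure Ω) [IsProbabilityMeasure ν]
      (h : Ω → ℝ) (t a : ℝ), Measurable h → (∀ x, |h x| ≤ B) →
      Integrable (fun x => Real.exp (t * (h x - a))) ν := fun ν _ h t a hm hb =>
    integrable_exp_mul_of_mem_Icc (a := -B - a) (b := B - a) (hm.sub_const a).aemeasurable
      (Filter.Eventually.of_forall fun x => by
        have := abs_le.1 (hb x); constructor <;> linarith)
  induction n with
  | zero =>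
    intro f hf hB hc
    have : (fun x => f x - ∫ x, f x ∂(Measure.pi fun _ : Fin 0 => μ)) = fun _ => 0 := by
      funext x
      have h1 : f = fun _ => f x := funext fun y => by rw [Subsingleton.elim y x]
      rw [h1]; simp
    rw [this]
    simp
  | succ n ih =>
    intro f hf hB hc
    let g : (Fin n → Z) → ℝ := fun x => ∫ z, f (Fin.cons z x) ∂μ
    have hmp := measurePreserving_piFinSuccAbove (fun _ : Fin (n + 1) => μ) 0
    have hcons : Measurable fun p : Z × (Fin n → Z) => (Fin.cons p.1 p.2 : Fin (n + 1) → Z) := by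
      refine measurable_pi_iff.2 fun i => ?_
      refine Fin.cases ?_ (fun j => ?_) i
      · simpa using measurable_fst
      · simpa [Function.comp_def] using (measurable_pi_apply j).comp measurable_snd
    have hF : Measurable fun p : Z × (Fin n → Z) => f (Fin.cons p.1 p.2) := hf.comp hcons
    have hsplit : ∀ u : (Fin (n + 1) → Z) → ℝ,
        ∫ x, u x ∂(Measure.pi fun _ => μ)
          = ∫ p, u (Fin.cons p.1 p.2) ∂(μ.prod (Measure.pi fun _ : Fin n => μ)) := by
      intro u
      rw [← hmp.integral_comp' (g := fun p : Z × (Fin n → Z) => u (Fin.cons p.1 p.2))]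
      refine integral_congr_ae (Filter.Eventually.of_forall fun x => ?_)
      change u x = u (Fin.cons (x 0) (fun j => x ((0 : Fin (n + 1)).succAbove j)))
      simp only [Fin.zero_succAbove]
      exact congrArg u (Fin.cons_self_tail x).symm
    have hgm : Measurable g := by
      have : StronglyMeasurable fun p : (Fin n → Z) × Z => f (Fin.cons p.2 p.1) :=
        (hF.comp measurable_swap).stronglyMeasurable
      exact this.integral_prod_right.measurable
    have hFx : ∀ x : Fin n → Z, Measurable fun z => f (Fin.cons z x) := fun x =>
      hF.comp (measurable_id.prodMk measurable_const)
    have hgB : ∀ x, |g x| ≤ B := by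
      intro x
      have := norm_integral_le_of_norm_le_const (μ := μ) (f := fun z => f (Fin.cons z x)) (C := B)
        (Filter.Eventually.of_forall fun z => hB _)
      simpa using this
    have hgc : ∀ x i z, |g (Function.update x i z) - g x| ≤ c := by
      intro x i z
      have h1 : g (Function.update x i z) - g x
          = ∫ w, (f (Fin.cons w (Function.update x i z)) - f (Fin.cons w x)) ∂μ :=
        (integral_sub (hint μ _ (hFx _) fun _ => hB _) (hint μ _ (hFx _) fun _ => hB _)).symm
      rw [h1]
      have := norm_integral_le_of_norm_le_const (μ := μ)
        (f := fun w => f (Fin.cons w (Function.update x i z)) - f (Fin.cons w x)) (C := c)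
        (Filter.Eventually.of_forall fun w => by
          rw [Fin.cons_update]; exact hc _ _ _)
      simpa using this
    have hEg : ∫ x, f x ∂(Measure.pi fun _ => μ) = ∫ x, g x ∂(Measure.pi fun _ => μ) := by
      rw [hsplit f, integral_prod_symm _ (hint _ _ hF fun _ => hB _)]
    -- Hoeffding's lemma for the first coordinate, the others being fixed
    have hoeff : ∀ (x : Fin n → Z) (t : ℝ),
        ∫ z, Real.exp (t * (f (Fin.cons z x) - g x)) ∂μ
          ≤ Real.exp (((c / 2 : NNReal) ^ 2 : NNReal) * t ^ 2 / 2) := by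
      intro x t
      have hosc : ∀ z w, f (Fin.cons z x) ≤ f (Fin.cons w x) + c := by
        intro z w
        have := hc (Fin.cons w x) 0 z
        rw [Fin.update_cons_zero] at this
        linarith [(abs_le.1 this).2]
      obtain ⟨z₀⟩ := μ.nonempty_of_neZero
      have hbdd : BddBelow (Set.range fun z => f (Fin.cons z x)) :=
        ⟨-B, by rintro _ ⟨z, rfl⟩; exact (abs_le.1 (hB _)).1⟩
      have : Nonempty Z := ⟨z₀⟩
      have hmem : ∀ z, f (Fin.cons z x) ∈
          Set.Icc (⨅ z, f (Fin.cons z x)) ((⨅ z, f (Fin.cons z x)) + c) := fun z =>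
        ⟨ciInf_le hbdd z, by
          have := le_ciInf (f := fun w => f (Fin.cons w x)) (c := f (Fin.cons z x) - c)
            fun w => by linarith [hosc z w]
          linarith⟩
      have h := (hasSubgaussianMGF_of_mem_Icc (μ := μ) (hFx x).aemeasurable
        (Filter.Eventually.of_forall hmem)).mgf_le t
      simpa [mgf] using h
    have hih := ih g hgm hgB hgc
    refine ⟨fun t => hexp _ f t _ hf hB, fun t => ?_⟩
    rw [mgf, hsplit, hEg]
    set a := ∫ x, g x ∂(Measure.pi fun _ : Fin n => μ) with ha
    rw [integral_prod_symm _ (hexp _ (fun p : Z × (Fin n → Z) => f (Fin.cons p.1 p.2)) t a hF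
      fun _ => hB _)]
    have hle : ∀ x : Fin n → Z, ∫ z, Real.exp (t * (f (Fin.cons z x) - a)) ∂μ
        ≤ Real.exp (((c / 2 : NNReal) ^ 2 : NNReal) * t ^ 2 / 2) * Real.exp (t * (g x - a)) := by
      intro x
      have : ∀ z, Real.exp (t * (f (Fin.cons z x) - a))
          = Real.exp (t * (f (Fin.cons z x) - g x)) * Real.exp (t * (g x - a)) := by
        intro z; rw [← Real.exp_add]; ring_nf
      simp_rw [this]
      rw [integral_mul_const]
      exact mul_le_mul_of_nonneg_right (hoeff x t) (Real.exp_pos _).le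
    have hintL : Integrable (fun x : Fin n → Z => ∫ z, Real.exp (t * (f (Fin.cons z x) - a)) ∂μ)
        (Measure.pi fun _ => μ) :=
      (hexp (μ.prod (Measure.pi fun _ : Fin n => μ))
        (fun p : Z × (Fin n → Z) => f (Fin.cons p.1 p.2)) t a hF fun _ => hB _).integral_prod_right
    refine (integral_mono hintL ((hexp _ g t a hgm hgB).const_mul _) hle).trans ?_
    rw [integral_const_mul]
    refine (mul_le_mul_of_nonneg_left (hih.mgf_le t) (Real.exp_pos _).le).trans_eq ?_
    rw [← Real.exp_add]
    push_cast
    ring_nf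

/-- McDiarmid's inequality for a finite family of independent variables with a common law, as a
bound on the moment generating function. -/
theorem hasSubgaussianMGF_pi {ι Z : Type*} [Fintype ι] [DecidableEq ι] [MeasurableSpace Z]
    (μ : Measure Z) [IsProbabilityMeasure μ] (c : NNReal) (B : ℝ)
    (f : (ι → Z) → ℝ) (hf : Measurable f) (hB : ∀ x, |f x| ≤ B)
    (hc : ∀ x i z, |f (Function.update x i z) - f x| ≤ c) :
    HasSubgaussianMGF (fun x => f x - ∫ x, f x ∂(Measure.pi fun _ => μ))
      (Fintype.card ι * (c / 2) ^ 2) (Measure.pi fun _ => μ) := by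
  let ε := Fintype.equivFin ι
  let T := MeasurableEquiv.piCongrLeft (fun _ : Fin (Fintype.card ι) => Z) ε
  have hT : MeasurePreserving T (Measure.pi fun _ => μ) (Measure.pi fun _ => μ) :=
    measurePreserving_piCongrLeft (fun _ => μ) ε
  have hTs : ∀ y, T.symm y = fun i => y (ε i) := fun y => rfl
  have h := hasSubgaussianMGF_pi_fin μ c B (Fintype.card ι) (fun y => f (T.symm y))
    (hf.comp T.symm.measurable) (fun _ => hB _) (fun y j z => by
      have : T.symm (Function.update y j z) = Function.update (T.symm y) (ε.symm j) z := by
        funext i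
        simp only [hTs, Function.update_apply, Equiv.eq_symm_apply]
      rw [this]
      exact hc _ _ _)
  have hE : ∫ y, f (T.symm y) ∂(Measure.pi fun _ => μ) = ∫ x, f x ∂(Measure.pi fun _ => μ) :=
    hT.symm.integral_comp' f
  rw [hE] at h
  have h2 := HasSubgaussianMGF.of_map (X := fun y => f (T.symm y) -
    ∫ x, f x ∂(Measure.pi fun _ => μ)) (Y := T) hT.measurable.aemeasurable
    (by rw [hT.map_eq]; exact h)
  simpa [Function.comp_def] using h2

/-! ### Deviation of an empirical mean from the expectation -/

/-- The deviation `∫ h dμ - (1 / |ι|) ∑ j, h (S j)` of the empirical mean of `h` on the sample `S`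
from its expectation. -/
noncomputable def empiricalGap {ι Z : Type*} [Fintype ι] [MeasurableSpace Z] (μ : Measure Z)
    (h : Z → ℝ) (S : ι → Z) : ℝ :=
  ∫ z, h z ∂μ - (1 / (Fintype.card ι : ℝ)) * ∑ j, h (S j)

section Gap

variable {ι Z : Type*} [Fintype ι] [MeasurableSpace Z] {μ : Measure Z}

theorem measurable_empiricalGap {h : Z → ℝ} (hm : Measurable h) :
    Measurable (empiricalGap (ι := ι) μ h) := by
  unfold empiricalGap
  refine measurable_const.sub (Measurable.const_mul ?_ _)
  exact Finset.measurable_sum _ fun j _ => hm.comp (measurable_pi_apply j)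

theorem abs_empiricalGap_update_sub_le [DecidableEq ι] {h : Z → ℝ} {w : ℝ}
    (hw : ∀ z z', |h z - h z'| ≤ w) (S : ι → Z) (j : ι) (z : Z) :
    |empiricalGap μ h (Function.update S j z) - empiricalGap μ h S| ≤ w / Fintype.card ι := by
  have h1 : ∑ i, h (Function.update S j z i) - ∑ i, h (S i) = h z - h (S j) := by
    rw [← Finset.sum_sub_distrib, Finset.sum_eq_single j]
    · simp
    · intro i _ hij; simp [hij]
    · simp
  have h2 : empiricalGap μ h (Function.update S j z) - empiricalGap μ h S
      = (h (S j) - h z) / Fintype.card ι := by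
    unfold empiricalGap
    linear_combination (-(1 / (Fintype.card ι : ℝ))) * h1
  rw [h2, abs_div, Nat.abs_cast]
  gcongr
  exact hw _ _

theorem empiricalGap_sub {g h : Z → ℝ} (hg : Integrable g μ) (hh : Integrable h μ) (S : ι → Z) :
    empiricalGap μ (fun z => g z - h z) S = empiricalGap μ g S - empiricalGap μ h S := by
  unfold empiricalGap
  rw [integral_sub hg hh, Finset.sum_sub_distrib]
  ring

variable [IsProbabilityMeasure μ] [Nonempty ι]

theorem abs_empiricalGap_le {h : Z → ℝ} {w : ℝ} (hw : ∀ z, |h z| ≤ w) (S : ι → Z) :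
    |empiricalGap μ h S| ≤ 2 * w := by
  have hN : (0 : ℝ) < Fintype.card ι := by exact_mod_cast Fintype.card_pos
  have h1 : |∫ z, h z ∂μ| ≤ w := by
    have := norm_integral_le_of_norm_le_const (μ := μ) (f := h) (C := w)
      (Filter.Eventually.of_forall hw)
    simpa using this
  have h2 : |(1 / (Fintype.card ι : ℝ)) * ∑ j, h (S j)| ≤ w := by
    rw [abs_mul, abs_of_pos (by positivity), one_div, inv_mul_le_iff₀ hN]
    refine (Finset.abs_sum_le_sum_abs _ _).trans ?_
    refine (Finset.sum_le_sum fun j _ => hw (S j)).trans_eq ?_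
    simp
  unfold empiricalGap
  refine (abs_sub _ _).trans ?_
  linarith

theorem integral_empiricalGap {h : Z → ℝ} (hh : Integrable h μ) :
    ∫ S, empiricalGap μ h S ∂(Measure.pi fun _ : ι => μ) = 0 := by
  have hN : (Fintype.card ι : ℝ) ≠ 0 := by exact_mod_cast Fintype.card_ne_zero
  have hev : ∀ j : ι, MeasurePreserving (Function.eval j) (Measure.pi fun _ : ι => μ) μ :=
    fun j => measurePreserving_eval (fun _ : ι => μ) j
  have hj : ∀ j : ι, Integrable (fun S : ι → Z => h (S j)) (Measure.pi fun _ : ι => μ) :=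
    fun j => (hev j).integrable_comp_of_integrable hh
  have hEj : ∀ j : ι, ∫ S : ι → Z, h (S j) ∂(Measure.pi fun _ : ι => μ) = ∫ z, h z ∂μ := by
    intro j
    conv_rhs => rw [← (hev j).map_eq]
    rw [integral_map (hev j).measurable.aemeasurable
      (by rw [(hev j).map_eq]; exact hh.aestronglyMeasurable)]
  unfold empiricalGap
  rw [integral_sub (integrable_const _) ((integrable_finsetSum _ fun j _ => hj j).const_mul _),
    integral_const_mul, integral_finsetSum _ fun j _ => hj j]
  simp [hEj, hN]

theorem hasSubgaussianMGF_empiricalGap {h : Z → ℝ} {w B : ℝ} (hm : Measurable h) (hw0 : 0 ≤ w)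
    (hB : ∀ z, |h z| ≤ B) (hw : ∀ z z', |h z - h z'| ≤ w) :
    HasSubgaussianMGF (empiricalGap (ι := ι) μ h)
      (Fintype.card ι * ((w / Fintype.card ι).toNNReal / 2) ^ 2) (Measure.pi fun _ : ι => μ) := by
  classical
  have := hasSubgaussianMGF_pi μ (w / Fintype.card ι).toNNReal (2 * B) (empiricalGap (ι := ι) μ h)
    (measurable_empiricalGap hm) (abs_empiricalGap_le hB) (fun S j z => by
      rw [Real.coe_toNNReal _ (by positivity)]
      exact abs_empiricalGap_update_sub_le hw S j z)
  rw [integral_empiricalGap (Integrable.of_bound hm.aestronglyMeasurable B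
    (Filter.Eventually.of_forall hB))] at this
  simpa using this

end Gap

/-! ### Chaining -/

/-- Maximal inequality for at most `M` sub-Gaussian variables. The majorant comes from
`log u ≤ u / a - 1 + log a`, applied to the sum `u` of the exponentials of the variables at
inverse temperature `1 / σ`, with `a` the bound on the expectation of that sum. -/
theorem exists_integrable_majorant {Ω J : Type*} [MeasurableSpace Ω] {ν : Measure Ω}
    [IsProbabilityMeasure ν] (P : Finset J) (Y : J → Ω → ℝ) {c : NNReal} {σ M : ℝ} (hσ : 0 < σ)
    (hc : (c : ℝ) ≤ σ ^ 2) (hM : 0 < M) (hPM : (P.card : ℝ) ≤ M)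
    (hY : ∀ j ∈ P, HasSubgaussianMGF (Y j) c ν) :
    ∃ U : Ω → ℝ, Integrable U ν ∧ (∀ ω, ∀ j ∈ P, Y j ω ≤ U ω) ∧
      ∫ ω, U ω ∂ν ≤ σ * (Real.log M + 1 / 2) := by
  set a := M * Real.exp (1 / 2) with ha
  have ha0 : 0 < a := by positivity
  have hi : ∀ j ∈ P, Integrable (fun ω => Real.exp (1 / σ * Y j ω)) ν := fun j hj =>
    (hY j hj).integrable_exp_mul _
  have hs : Integrable (fun ω => ∑ j ∈ P, Real.exp (1 / σ * Y j ω)) ν :=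
    integrable_finsetSum _ hi
  refine ⟨fun ω => σ * ((∑ j ∈ P, Real.exp (1 / σ * Y j ω)) / a + (Real.log a - 1)),
    ((hs.div_const a).add (integrable_const _)).const_mul σ, ?_, ?_⟩
  · intro ω j hj
    have h1 : Real.exp (1 / σ * Y j ω) / a ≤ (∑ j ∈ P, Real.exp (1 / σ * Y j ω)) / a := by
      gcongr
      exact Finset.single_le_sum (f := fun j => Real.exp (1 / σ * Y j ω))
        (fun j _ => (Real.exp_pos _).le) hj
    have h2 := Real.log_le_sub_one_of_pos (div_pos (Real.exp_pos (1 / σ * Y j ω)) ha0)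
    rw [Real.log_div (Real.exp_pos _).ne' ha0.ne', Real.log_exp] at h2
    have h3 : Y j ω = σ * (1 / σ * Y j ω) := by field_simp
    rw [h3]
    exact mul_le_mul_of_nonneg_left (by linarith) hσ.le
  · rw [integral_const_mul, integral_add (hs.div_const a) (integrable_const _), integral_div,
      integral_finsetSum _ hi]
    refine mul_le_mul_of_nonneg_left ?_ hσ.le
    have h1 : ∑ j ∈ P, ∫ ω, Real.exp (1 / σ * Y j ω) ∂ν ≤ a := by
      have h2 : ∀ j ∈ P, ∫ ω, Real.exp (1 / σ * Y j ω) ∂ν ≤ Real.exp (1 / 2) := by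
        intro j hj
        refine ((hY j hj).mgf_le (1 / σ)).trans (Real.exp_le_exp.2 ?_)
        rw [one_div, inv_pow, ← div_eq_mul_inv, div_div, div_le_div_iff₀ (by positivity) two_pos]
        linarith
      refine (Finset.sum_le_sum h2).trans ?_
      rw [Finset.sum_const, nsmul_eq_mul]
      exact mul_le_mul_of_nonneg_right hPM (Real.exp_pos _).le
    have h3 : (∑ j ∈ P, ∫ ω, Real.exp (1 / σ * Y j ω) ∂ν) / a ≤ 1 := (div_le_one ha0).2 h1
    have h4 : Real.log a = Real.log M + 1 / 2 := by
      rw [ha, Real.log_mul hM.ne' (Real.exp_pos _).ne', Real.log_exp]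
    simp only [integral_const, probReal_univ, one_smul]
    linarith

theorem sum_range_succ_div_two_pow_le (n : ℕ) :
    ∑ k ∈ Finset.range n, ((k : ℝ) + 1) / 2 ^ k ≤ 4 := by
  have h : ∑ k ∈ Finset.range n, ((k : ℝ) + 1) / 2 ^ k = 4 - (2 * n + 4) / 2 ^ n := by
    induction n with
    | zero => norm_num
    | succ n ih =>
      rw [Finset.sum_range_succ, ih]
      push_cast
      field_simp
      ring
  rw [h]
  have : (0 : ℝ) ≤ (2 * n + 4) / 2 ^ n := by positivity
  linarith

section LipschitzFamily

variable {I E ι Z : Type*} [NormedAddCommGroup E]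
  [Fintype ι] [Nonempty ι] [MeasurableSpace Z] {μ : Measure Z} [IsProbabilityMeasure μ]
  {e : I → E} {f : I → Z → ℝ} {K : ℝ}

theorem empiricalGap_le_add_mul_norm_sub (hfm : ∀ i, Measurable (f i)) (hf0 : ∀ i z, 0 ≤ f i z)
    (hf1 : ∀ i z, f i z ≤ 1) (hfK : ∀ i j z, |f i z - f j z| ≤ K * ‖e i - e j‖) (i j : I)
    (S : ι → Z) :
    empiricalGap μ (f i) S ≤ empiricalGap μ (f j) S + 2 * K * ‖e i - e j‖ := by
  have hfi : ∀ i, Integrable (f i) μ := fun i => Integrable.of_bound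
    (hfm i).aestronglyMeasurable 1 (Filter.Eventually.of_forall fun z => by
      rw [Real.norm_eq_abs, abs_of_nonneg (hf0 i z)]; exact hf1 i z)
  have h1 := abs_empiricalGap_le (μ := μ) (fun z => hfK i j z) S
  rw [empiricalGap_sub (hfi i) (hfi j)] at h1
  linarith [(abs_le.1 h1).2]

variable [NormedSpace ℝ E] [FiniteDimensional ℝ E]

/-- Nets of the index set at scale `2 / 2 ^ k`, as maps to nearest points; at scale `0` a single
point `i₀` is enough because the diameter is at most `2`. -/
theorem exists_net_projection (he : ∀ i, ‖e i‖ ≤ 1) (i₀ : I) (k : ℕ) :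
    ∃ (s : Finset I) (p : I → I), (∀ i, p i ∈ s) ∧
      (s.card : ℝ) ≤ 2 ^ ((k + 1) * Module.finrank ℝ E) ∧
      (∀ i, ‖e i - e (p i)‖ ≤ 2 / 2 ^ k) ∧ (k = 0 → ∀ i, p i = i₀) := by
  rcases Nat.eq_zero_or_pos k with rfl | hk
  · refine ⟨{i₀}, fun _ => i₀, by simp, ?_, fun i => ?_, fun _ _ => rfl⟩
    · simpa using one_le_pow₀ (one_le_two (α := ℝ))
    · have := norm_sub_le (e i) (e i₀)
      norm_num
      linarith [he i, he i₀]
  · obtain ⟨s, hs, hp⟩ := exists_finset_net e he (ε := 2 / 2 ^ k) (by positivity)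
    choose p hp using hp
    refine ⟨s, p, fun i => (hp i).1, hs.trans ?_, fun i => (hp i).2, fun h => by omega⟩
    rw [pow_mul]
    gcongr
    have : (1 : ℝ) ≤ 2 ^ k := one_le_pow₀ one_le_two
    rw [pow_succ]
    field_simp
    linarith

/-- Chaining for `K > 0`: each deviation is telescoped along the nets at scales `2 / 2 ^ k`. The
increments at scale `k` are sub-Gaussian at scale `3 K / (2 ^ k √N)`, and there are at
most `2 ^ ((2 k + 3) D)` of them, so their expected maxima are summable in `k`. -/
theorem integral_sup_empiricalGap_le_of_pos (he : ∀ i, ‖e i‖ ≤ 1) (hK : 0 < K)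
    (hfm : ∀ i, Measurable (f i)) (hf0 : ∀ i z, 0 ≤ f i z)
    (hf1 : ∀ i z, f i z ≤ 1) (hfK : ∀ i j z, |f i z - f j z| ≤ K * ‖e i - e j‖)
    (F : Finset I) (hF : F.Nonempty)
    (hint : Integrable (fun S : ι → Z => F.sup' hF fun i => empiricalGap μ (f i) S)
      (Measure.pi fun _ : ι => μ)) :
    ∫ S, (F.sup' hF fun i => empiricalGap μ (f i) S) ∂(Measure.pi fun _ : ι => μ) ≤
      12 * (3 * Module.finrank ℝ E + 1) * K / √(Fintype.card ι) := by
  classical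
  set D := Module.finrank ℝ E
  set N : ℝ := ((Fintype.card ι : ℕ) : ℝ) with hN
  have hN0 : 0 < N := by rw [hN]; exact_mod_cast Fintype.card_pos
  have hsN : 0 < √N := Real.sqrt_pos.2 hN0
  obtain ⟨i₀, -⟩ := id hF
  have hfa : ∀ i z, |f i z| ≤ 1 := fun i z => by
    rw [abs_of_nonneg (hf0 i z)]; exact hf1 i z
  have hfi : ∀ i, Integrable (f i) μ := fun i => Integrable.of_bound
    (hfm i).aestronglyMeasurable 1 (Filter.Eventually.of_forall fun z => hfa i z)
  choose s p hps hcard hdist hzero using exists_net_projection he i₀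
  -- The increments of the chain between scales `k` and `k + 1` form a finite family.
  have hU : ∀ k : ℕ, ∃ U : (ι → Z) → ℝ, Integrable U (Measure.pi fun _ : ι => μ) ∧
      (∀ S, ∀ i, empiricalGap μ (f (p (k + 1) i)) S ≤ empiricalGap μ (f (p k i)) S + U S) ∧
      ∫ S, U S ∂(Measure.pi fun _ : ι => μ)
        ≤ 3 * (3 * D + 1) * K / √N * (((k : ℝ) + 1) / 2 ^ k) := by
    intro k
    let P : Finset (I × I) := (s (k + 1) ×ˢ s k).filter fun q => ‖e q.1 - e q.2‖ ≤ 3 / 2 ^ k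
    have hPM : (P.card : ℝ) ≤ 2 ^ ((2 * k + 3) * D) := by
      have h1 : (P.card : ℝ) ≤ (s (k + 1)).card * (s k).card := by
        rw [← Nat.cast_mul, ← Finset.card_product]
        exact_mod_cast Finset.card_filter_le _ _
      refine h1.trans ((mul_le_mul (hcard (k + 1)) (hcard k) (by positivity)
        (by positivity)).trans_eq ?_)
      rw [← pow_add]
      congr 1
      ring
    have hσ : 0 < 3 * K / (2 ^ k * √N) := by positivity
    have hw0 : 0 ≤ 2 * (K * (3 / 2 ^ k)) := by positivity
    obtain ⟨U, hUi, hUle, hUE⟩ := exists_integrable_majorant (ν := Measure.pi fun _ : ι => μ) P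
      (fun q => empiricalGap μ fun z => f q.1 z - f q.2 z)
      (c := Fintype.card ι * ((2 * (K * (3 / 2 ^ k)) / Fintype.card ι).toNNReal / 2) ^ 2)
      (M := 2 ^ ((2 * k + 3) * D)) hσ (by
        push_cast
        rw [Real.coe_toNNReal _ (by positivity), ← hN, div_pow (3 * K), mul_pow _ (√N),
          Real.sq_sqrt hN0.le]
        apply le_of_eq
        field_simp) (by positivity) hPM (by
        intro q hq
        have hq2 := (Finset.mem_filter.1 hq).2
        have hb : ∀ z, |f q.1 z - f q.2 z| ≤ K * (3 / 2 ^ k) := fun z =>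
          (hfK _ _ _).trans (mul_le_mul_of_nonneg_left hq2 hK.le)
        refine hasSubgaussianMGF_empiricalGap ((hfm _).sub (hfm _)) hw0 hb fun z z' => ?_
        refine (abs_sub _ _).trans ?_
        linarith [hb z, hb z'])
    refine ⟨U, hUi, fun S i => ?_, hUE.trans ?_⟩
    · have hmem : (p (k + 1) i, p k i) ∈ P := by
        refine Finset.mem_filter.2 ⟨Finset.mk_mem_product (hps _ _) (hps _ _), ?_⟩
        have h1 := norm_sub_le (e (p (k + 1) i) - e i) (e (p k i) - e i)
        rw [sub_sub_sub_cancel_right, norm_sub_rev _ (e i), norm_sub_rev _ (e i)] at h1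
        refine h1.trans ((add_le_add (hdist (k + 1) i) (hdist k i)).trans_eq ?_)
        rw [pow_succ]
        field_simp
        norm_num
      have := hUle S _ hmem
      rw [empiricalGap_sub (hfi _) (hfi _)] at this
      linarith
    · have hlog : Real.log (2 ^ ((2 * k + 3) * D)) ≤ (2 * k + 3) * D := by
        rw [Real.log_pow]
        push_cast
        have : (0 : ℝ) ≤ (2 * k + 3) * D := by positivity
        nlinarith [Real.log_two_lt_d9]
      have hbr : Real.log (2 ^ ((2 * k + 3) * D)) + 1 / 2 ≤ (3 * D + 1) * (k + 1) := by
        have h1 : (0 : ℝ) ≤ k := by positivity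
        have h2 : (0 : ℝ) ≤ D := by positivity
        nlinarith [mul_nonneg h1 h2]
      refine (mul_le_mul_of_nonneg_left hbr hσ.le).trans_eq ?_
      field_simp
  choose U hUi hUle hUE using hU
  have hchain : ∀ S i n, empiricalGap μ (f (p n i)) S
      ≤ empiricalGap μ (f i₀) S + ∑ k ∈ Finset.range n, U k S := by
    intro S i n
    induction n with
    | zero => simp [hzero 0 rfl i]
    | succ n ih =>
      rw [Finset.sum_range_succ]
      linarith [hUle n S i]
  have hgi : Integrable (empiricalGap μ (f i₀)) (Measure.pi fun _ : ι => μ) :=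
    Integrable.of_bound (measurable_empiricalGap (hfm i₀)).aestronglyMeasurable (2 * 1)
      (Filter.Eventually.of_forall fun S => abs_empiricalGap_le (hfa i₀) S)
  have hbound : ∀ n : ℕ,
      ∫ S, (F.sup' hF fun i => empiricalGap μ (f i) S) ∂(Measure.pi fun _ : ι => μ) ≤
      12 * (3 * D + 1) * K / √N + 4 * K * (1 / 2) ^ n := by
    intro n
    have hUs := integrable_finsetSum (Finset.range n) fun k _ => hUi k
    have hmaj : ∀ S, (F.sup' hF fun i => empiricalGap μ (f i) S) ≤
        (empiricalGap μ (f i₀) S + ∑ k ∈ Finset.range n, U k S) + 4 * K * (1 / 2) ^ n := by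
      intro S
      refine Finset.sup'_le _ _ fun i _ => ?_
      have h1 := empiricalGap_le_add_mul_norm_sub (μ := μ) hfm hf0 hf1 hfK i (p n i) S
      have h2 : 2 * K * ‖e i - e (p n i)‖ ≤ 2 * K * (2 / 2 ^ n) :=
        mul_le_mul_of_nonneg_left (hdist n i) (by positivity)
      have h3 : 2 * K * (2 / 2 ^ n) = 4 * K * (1 / 2) ^ n := by
        rw [one_div, inv_pow]; field_simp; norm_num
      linarith [hchain S i n]
    refine (integral_mono hint ((hgi.add hUs).add (integrable_const _)) hmaj).trans ?_
    have e1 := integral_add (hgi.add hUs)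
      (integrable_const (μ := Measure.pi fun _ : ι => μ) (4 * K * (1 / 2 : ℝ) ^ n))
    have e2 := integral_add hgi hUs
    simp only [Pi.add_apply] at e1 e2 ⊢
    rw [e1, e2, integral_empiricalGap (hfi i₀), integral_finsetSum _ fun k _ => hUi k]
    simp only [integral_const, probReal_univ, one_smul, zero_add]
    gcongr
    refine (Finset.sum_le_sum fun k _ => hUE k).trans ?_
    rw [← Finset.mul_sum]
    refine (mul_le_mul_of_nonneg_left (sum_range_succ_div_two_pow_le n) (by positivity)).trans_eq ?_
    ring
  have hlim : Filter.Tendsto (fun n : ℕ => 12 * (3 * (D : ℝ) + 1) * K / √N + 4 * K * (1 / 2) ^ n)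
      Filter.atTop (nhds (12 * (3 * (D : ℝ) + 1) * K / √N)) := by
    have := (tendsto_pow_atTop_nhds_zero_of_lt_one (r := (1 / 2 : ℝ)) (by norm_num)
      (by norm_num)).const_mul (4 * K)
    simpa using this.const_add (12 * (3 * (D : ℝ) + 1) * K / √N)
  exact ge_of_tendsto' hlim hbound

/-- Chaining bound for the expected maximal deviation over a finite subfamily: no logarithm of the
sample size or of the number of functions is lost. -/
theorem integral_sup_empiricalGap_le (he : ∀ i, ‖e i‖ ≤ 1) (hK : 0 ≤ K)
    (hfm : ∀ i, Measurable (f i)) (hf0 : ∀ i z, 0 ≤ f i z)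
    (hf1 : ∀ i z, f i z ≤ 1) (hfK : ∀ i j z, |f i z - f j z| ≤ K * ‖e i - e j‖)
    (F : Finset I) (hF : F.Nonempty)
    (hint : Integrable (fun S : ι → Z => F.sup' hF fun i => empiricalGap μ (f i) S)
      (Measure.pi fun _ : ι => μ)) :
    ∫ S, (F.sup' hF fun i => empiricalGap μ (f i) S) ∂(Measure.pi fun _ : ι => μ) ≤
      12 * (3 * Module.finrank ℝ E + 1) * K / √(Fintype.card ι) := by
  have hlim : Filter.Tendsto
      (fun x : ℝ => 12 * (3 * (Module.finrank ℝ E : ℝ) + 1) * x / √(Fintype.card ι))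
      (nhdsWithin K (Set.Ioi K))
      (nhds (12 * (3 * (Module.finrank ℝ E : ℝ) + 1) * K / √(Fintype.card ι))) := by
    refine Filter.Tendsto.mono_left (Continuous.tendsto ?_ K) nhdsWithin_le_nhds
    fun_prop
  refine ge_of_tendsto hlim ?_
  filter_upwards [self_mem_nhdsWithin] with x hx
  have hx' : K < x := hx
  exact integral_sup_empiricalGap_le_of_pos he (hK.trans_lt hx') hfm hf0 hf1
    (fun i j z => (hfK i j z).trans (mul_le_mul_of_nonneg_right hx'.le (norm_nonneg _))) F hF hint

/-! ### Uniform deviation with high probability -/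

/-- McDiarmid's inequality for the maximal deviation over a finite subfamily, which changes by at
most `1 / |ι|` with one sample point, together with the chaining bound on its expectation. -/
theorem measureReal_exists_lt_empiricalGap_le (he : ∀ i, ‖e i‖ ≤ 1) (hK : 0 ≤ K)
    (hfm : ∀ i, Measurable (f i)) (hf0 : ∀ i z, 0 ≤ f i z)
    (hf1 : ∀ i z, f i z ≤ 1) (hfK : ∀ i j z, |f i z - f j z| ≤ K * ‖e i - e j‖)
    {δ : ℝ} (hδ : 0 < δ) (hδ1 : δ ≤ 1) (F : Finset I) :
    (Measure.pi fun _ : ι => μ).real {S | ∃ i ∈ F,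
      12 * (3 * Module.finrank ℝ E + 1) * K / √(Fintype.card ι)
        + √(Real.log (1 / δ) / (2 * Fintype.card ι)) < empiricalGap μ (f i) S} ≤ δ := by
  classical
  rcases F.eq_empty_or_nonempty with rfl | hF
  · simpa using hδ.le
  set N : ℝ := ((Fintype.card ι : ℕ) : ℝ) with hN
  have hN0 : 0 < N := by rw [hN]; exact_mod_cast Fintype.card_pos
  have hlog : 0 ≤ Real.log (1 / δ) := Real.log_nonneg (by rw [le_div_iff₀ hδ]; linarith)
  have hfa : ∀ i z, |f i z| ≤ 1 := fun i z => by
    rw [abs_of_nonneg (hf0 i z)]; exact hf1 i z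
  let G : (ι → Z) → ℝ := fun S => F.sup' hF fun i => empiricalGap μ (f i) S
  have hGm : Measurable G := by
    have := Finset.measurable_sup' hF (f := fun i => empiricalGap (ι := ι) μ (f i))
      fun i _ => measurable_empiricalGap (hfm i)
    convert this using 1
    funext S
    simp [G, Finset.sup'_apply]
  have hGB : ∀ S, |G S| ≤ 2 * 1 := by
    intro S
    obtain ⟨i, -, hi⟩ := Finset.exists_mem_eq_sup' hF fun i => empiricalGap μ (f i) S
    change |F.sup' hF _| ≤ _
    rw [hi]
    exact abs_empiricalGap_le (hfa i) S
  have hupd : ∀ S j z, G (Function.update S j z) ≤ G S + 1 / N ∧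
      G S ≤ G (Function.update S j z) + 1 / N := by
    intro S j z
    have hd : ∀ i, |empiricalGap μ (f i) (Function.update S j z) - empiricalGap μ (f i) S|
        ≤ 1 / N := fun i => abs_empiricalGap_update_sub_le (fun z z' => by
          rw [abs_le]
          constructor <;> linarith [hf0 i z, hf0 i z', hf1 i z, hf1 i z']) S j z
    constructor
    · refine Finset.sup'_le _ _ fun i hi => ?_
      have := Finset.le_sup' (fun i => empiricalGap μ (f i) S) hi
      change _ ≤ F.sup' hF _ + _
      linarith [(abs_le.1 (hd i)).2]
    · refine Finset.sup'_le _ _ fun i hi => ?_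
      have := Finset.le_sup' (fun i => empiricalGap μ (f i) (Function.update S j z)) hi
      change _ ≤ F.sup' hF _ + _
      linarith [(abs_le.1 (hd i)).1]
  have hsub := hasSubgaussianMGF_pi μ (1 / N).toNNReal (2 * 1) G hGm hGB fun S j z => by
    rw [Real.coe_toNNReal _ (by positivity), abs_le]
    constructor <;> linarith [(hupd S j z).1, (hupd S j z).2]
  have hE := integral_sup_empiricalGap_le (ι := ι) (μ := μ) he hK hfm hf0 hf1 hfK F hF
    (Integrable.of_bound hGm.aestronglyMeasurable (2 * 1) (Filter.Eventually.of_forall hGB))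
  have htail := hsub.measure_ge_le (Real.sqrt_nonneg (Real.log (1 / δ) / (2 * N)))
  -- the deviation is chosen so that the sub-Gaussian tail equals `δ`
  have hval : Real.exp (-√(Real.log (1 / δ) / (2 * N)) ^ 2 /
      (2 * ((Fintype.card ι * ((1 / N).toNNReal / 2) ^ 2 : NNReal) : ℝ))) = δ := by
    rw [Real.sq_sqrt (by positivity)]
    push_cast
    rw [Real.coe_toNNReal _ (by positivity), ← hN]
    have : -(Real.log (1 / δ) / (2 * N)) / (2 * (N * (1 / N / 2) ^ 2)) = Real.log δ := by
      rw [one_div δ, Real.log_inv]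
      field_simp
    rw [this, Real.exp_log hδ]
  rw [hval] at htail
  refine (measureReal_mono ?_).trans htail
  rintro S ⟨i, hi, hlt⟩
  have hG : empiricalGap μ (f i) S ≤ G S :=
    Finset.le_sup' (fun i => empiricalGap μ (f i) S) hi
  rw [Set.mem_ofPred_eq]
  linarith

/-- Uniform deviation bound for a Lipschitz family of `[0, 1]`-valued functions indexed by a subset
of the unit ball of a finite-dimensional space. The good event is measurable although the family
may be uncountable, because the deviation is Lipschitz in the index and may be tested on a
countable union of finite nets. -/
theorem measurableSet_and_le_measureReal_forall_empiricalGap_le (he : ∀ i, ‖e i‖ ≤ 1) (hK : 0 ≤ K)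
    (hfm : ∀ i, Measurable (f i)) (hf0 : ∀ i z, 0 ≤ f i z)
    (hf1 : ∀ i z, f i z ≤ 1) (hfK : ∀ i j z, |f i z - f j z| ≤ K * ‖e i - e j‖)
    {δ : ℝ} (hδ : 0 < δ) (hδ1 : δ ≤ 1) :
    MeasurableSet {S : ι → Z | ∀ i, empiricalGap μ (f i) S ≤
      12 * (3 * Module.finrank ℝ E + 1) * K / √(Fintype.card ι)
        + √(Real.log (1 / δ) / (2 * Fintype.card ι))} ∧
    1 - δ ≤ (Measure.pi fun _ : ι => μ).real {S : ι → Z | ∀ i, empiricalGap μ (f i) S ≤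
      12 * (3 * Module.finrank ℝ E + 1) * K / √(Fintype.card ι)
        + √(Real.log (1 / δ) / (2 * Fintype.card ι))} := by
  classical
  set b : ℝ := 12 * (3 * Module.finrank ℝ E + 1) * K / √(Fintype.card ι)
        + √(Real.log (1 / δ) / (2 * Fintype.card ι)) with hb
  choose s _ hs using fun k : ℕ =>
    exists_finset_net e he (ε := 1 / ((k : ℝ) + 1)) (by positivity)
  let F : ℕ → Finset I := fun n => (Finset.range (n + 1)).biUnion s
  have hFmono : Monotone F := fun m n hmn =>
    Finset.biUnion_subset_biUnion_of_subset_left _ (Finset.range_mono (by omega))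
  let Bad : ℕ → Set (ι → Z) := fun n => {S | ∃ i ∈ F n, b < empiricalGap μ (f i) S}
  have hBadm : ∀ n, MeasurableSet (Bad n) := by
    intro n
    have : Bad n = ⋃ i ∈ F n, {S | b < empiricalGap μ (f i) S} := by
      ext S; simp [Bad]
    rw [this]
    exact Finset.measurableSet_biUnion _ fun i _ =>
      measurableSet_lt measurable_const (measurable_empiricalGap (hfm i))
  have hBadmono : Monotone Bad := fun m n hmn S ⟨i, hi, h⟩ => ⟨i, hFmono hmn hi, h⟩
  have heq : {S : ι → Z | ∀ i, empiricalGap μ (f i) S ≤ b} = (⋃ n, Bad n)ᶜ := by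
    ext S
    simp only [Set.mem_ofPred_eq, Set.mem_compl_iff, Set.mem_iUnion, not_exists]
    constructor
    · rintro h n ⟨i, -, hi⟩
      exact absurd (h i) (not_le.2 hi)
    · intro h i
      have hlim : Filter.Tendsto (fun k : ℕ => b + 2 * K * (1 / ((k : ℝ) + 1))) Filter.atTop
          (nhds b) := by
        simpa using (tendsto_one_div_add_atTop_nhds_zero_nat.const_mul (2 * K)).const_add b
      refine ge_of_tendsto' hlim fun k => ?_
      obtain ⟨j, hj, hij⟩ := hs k i
      have hjF : j ∈ F k := Finset.mem_biUnion.2 ⟨k, Finset.self_mem_range_succ k, hj⟩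
      have h1 : empiricalGap μ (f j) S ≤ b := not_lt.1 fun hlt => h k ⟨j, hjF, hlt⟩
      have h2 := empiricalGap_le_add_mul_norm_sub (μ := μ) hfm hf0 hf1 hfK i j S
      have h3 : 2 * K * ‖e i - e j‖ ≤ 2 * K * (1 / ((k : ℝ) + 1)) :=
        mul_le_mul_of_nonneg_left hij (by positivity)
      linarith
  have hUm : MeasurableSet (⋃ n, Bad n) := MeasurableSet.iUnion hBadm
  rw [heq]
  refine ⟨hUm.compl, ?_⟩
  rw [probReal_compl_eq_one_sub hUm]
  have hU : (Measure.pi fun _ : ι => μ) (⋃ n, Bad n) ≤ ENNReal.ofReal δ := by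
    rw [hBadmono.measure_iUnion]
    refine iSup_le fun n => ?_
    rw [← ofReal_measureReal]
    exact ENNReal.ofReal_le_ofReal
      (measureReal_exists_lt_empiricalGap_le he hK hfm hf0 hf1 hfK hδ hδ1 (F n))
  have := ENNReal.toReal_le_of_le_ofReal hδ.le hU
  have h2 : (Measure.pi fun _ : ι => μ).real (⋃ n, Bad n) ≤ δ := this
  linarith

end LipschitzFamily

/-! ### Networks as Lipschitz functions of their normalised weights -/

section Network

variable {L : ℕ} {n : Fin (L + 1) → ℕ} {ψ : NetNonlin n} {s : Fin L → ℝ}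

theorem hiddenState_succ (W : NetWeights n) (q : Euc (n 0)) (ℓ : Fin L) :
    hiddenState ψ W q ℓ.succ = ψ ℓ (W ℓ (hiddenState ψ W q ℓ.castSucc)) :=
  Fin.induction_succ _ _ _

theorem norm_hiddenState_le (hψ : ∀ ℓ, LipschitzWith 1 (ψ ℓ)) (hψ0 : ∀ ℓ, ψ ℓ 0 = 0)
    {W : NetWeights n} (hW : ∀ ℓ, ‖W ℓ‖ ≤ s ℓ) (q : Euc (n 0)) (ℓ : Fin (L + 1)) :
    ‖hiddenState ψ W q ℓ‖ ≤ Fin.partialProd s ℓ * ‖q‖ := by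
  induction ℓ using Fin.induction with
  | zero => simp [hiddenState]
  | succ ℓ ih =>
    rw [hiddenState_succ, Fin.partialProd_succ]
    have h1 := (hψ ℓ).norm_le_mul (hψ0 ℓ) (W ℓ (hiddenState ψ W q ℓ.castSucc))
    rw [NNReal.coe_one, one_mul] at h1
    calc _ ≤ ‖W ℓ (hiddenState ψ W q ℓ.castSucc)‖ := h1
      _ ≤ s ℓ * (Fin.partialProd s ℓ.castSucc * ‖q‖) :=
        (W ℓ).le_of_opNorm_le_of_le (hW ℓ) ih
      _ = _ := by ring

/-- Perturbing every layer by the relative amount `d` perturbs the state after `ℓ` layers by at most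
`ℓ d` times the bound `s₁ ⋯ s_ℓ ‖q‖` on its norm: each layer contributes one term, and the later
layers amplify it by their norm bounds only. -/
theorem norm_hiddenState_sub_le (hψ : ∀ ℓ, LipschitzWith 1 (ψ ℓ)) (hψ0 : ∀ ℓ, ψ ℓ 0 = 0)
    {W W' : NetWeights n} (hW : ∀ ℓ, ‖W ℓ‖ ≤ s ℓ) (hW' : ∀ ℓ, ‖W' ℓ‖ ≤ s ℓ) {d : ℝ}
    (hd : ∀ ℓ, ‖W ℓ - W' ℓ‖ ≤ s ℓ * d) (q : Euc (n 0)) (ℓ : Fin (L + 1)) :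
    ‖hiddenState ψ W q ℓ - hiddenState ψ W' q ℓ‖
      ≤ (ℓ : ℕ) * (Fin.partialProd s ℓ * ‖q‖ * d) := by
  induction ℓ using Fin.induction with
  | zero => simp [hiddenState]
  | succ ℓ ih =>
    rw [hiddenState_succ, hiddenState_succ, Fin.partialProd_succ]
    set a := hiddenState ψ W q ℓ.castSucc
    set a' := hiddenState ψ W' q ℓ.castSucc
    have h1 : ‖ψ ℓ (W ℓ a) - ψ ℓ (W' ℓ a')‖ ≤ ‖W ℓ a - W' ℓ a'‖ := by
      simpa using (hψ ℓ).norm_sub_le (W ℓ a) (W' ℓ a')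
    have h2 : W ℓ a - W' ℓ a' = W ℓ (a - a') + (W ℓ - W' ℓ) a' := by
      rw [map_sub, sub_apply]; abel
    calc _ ≤ ‖W ℓ (a - a') + (W ℓ - W' ℓ) a'‖ := h2 ▸ h1
      _ ≤ s ℓ * ((ℓ.castSucc : ℕ) * (Fin.partialProd s ℓ.castSucc * ‖q‖ * d))
          + s ℓ * d * (Fin.partialProd s ℓ.castSucc * ‖q‖) :=
        norm_add_le_of_le ((W ℓ).le_of_opNorm_le_of_le (hW ℓ) ih)
          ((W ℓ - W' ℓ).le_of_opNorm_le_of_le (hd ℓ) (norm_hiddenState_le hψ hψ0 hW' q _))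
      _ = _ := by
        rw [Fin.val_castSucc, Fin.val_succ]
        push_cast
        ring

theorem norm_encoder_sub_le (hψ : ∀ ℓ, LipschitzWith 1 (ψ ℓ)) (hψ0 : ∀ ℓ, ψ ℓ 0 = 0)
    {W W' : NetWeights n} (hW : ∀ ℓ, ‖W ℓ‖ ≤ s ℓ) (hW' : ∀ ℓ, ‖W' ℓ‖ ≤ s ℓ) {d : ℝ}
    (hd : ∀ ℓ, ‖W ℓ - W' ℓ‖ ≤ s ℓ * d) (q : Euc (n 0)) :
    ‖encoder ψ W q - encoder ψ W' q‖ ≤ L * ((∏ ℓ, s ℓ) * ‖q‖ * d) := by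
  have h := norm_hiddenState_sub_le hψ hψ0 hW hW' hd q (Fin.last L)
  have hp : Fin.partialProd s (Fin.last L) = ∏ ℓ, s ℓ := by
    rw [Fin.partialProd, List.take_of_length_le (by simp), List.prod_ofFn]
  rwa [hp, Fin.val_last] at h

theorem continuous_encoder (hψ : ∀ ℓ, LipschitzWith 1 (ψ ℓ)) (W : NetWeights n) :
    Continuous (encoder ψ W) := by
  have h : ∀ ℓ : Fin (L + 1), Continuous fun q => hiddenState ψ W q ℓ := by
    intro ℓ
    induction ℓ using Fin.induction with
    | zero => exact continuous_id
    | succ ℓ ih =>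
      simp_rw [hiddenState_succ]
      exact (hψ ℓ).continuous.comp ((W ℓ).continuous.comp ih)
  exact h (Fin.last L)

theorem continuous_diffFeature {𝒳 : Set (Euc (n 0))} (hψ : ∀ ℓ, LipschitzWith 1 (ψ ℓ))
    (W : NetWeights n) : Continuous fun x : QPair n 𝒳 => diffFeature ψ W x :=
  ((continuous_encoder hψ W).comp (continuous_subtype_val.comp continuous_fst)).sub continuous_snd

/-- The weights with each layer divided by its norm bound `s ℓ`. When `s ℓ = 0` the layer itself is
zero, and so is its normalisation because `0⁻¹ = 0`. -/
noncomputable def normalizedWeights (s : Fin L → ℝ) (W : NetWeights n) : NetWeights n :=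
  fun ℓ => (s ℓ)⁻¹ • W ℓ

theorem norm_normalizedWeights_le_one {W : NetWeights n} (hW : ∀ ℓ, ‖W ℓ‖ ≤ s ℓ) :
    ‖normalizedWeights s W‖ ≤ 1 := by
  refine (pi_norm_le_iff_of_nonneg zero_le_one).2 fun ℓ => ?_
  have hs : 0 ≤ s ℓ := (norm_nonneg _).trans (hW ℓ)
  rw [normalizedWeights, norm_smul, norm_inv, Real.norm_of_nonneg hs, inv_mul_eq_div]
  exact div_le_one_of_le₀ (hW ℓ) hs

theorem norm_sub_le_mul_norm_inv_smul_sub {F : Type*} [NormedAddCommGroup F] [NormedSpace ℝ F]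
    {c : ℝ} {x y : F} (hx : ‖x‖ ≤ c) (hy : ‖y‖ ≤ c) : ‖x - y‖ ≤ c * ‖c⁻¹ • x - c⁻¹ • y‖ := by
  rcases eq_or_ne c 0 with rfl | hc
  · rw [norm_le_zero_iff.1 hx, norm_le_zero_iff.1 hy]
    simp
  · rw [← smul_sub, norm_smul, norm_inv, Real.norm_of_nonneg ((norm_nonneg x).trans hx),
      mul_inv_cancel_left₀ hc]

theorem norm_sub_le_mul_norm_normalizedWeights_sub {W W' : NetWeights n} (hW : ∀ ℓ, ‖W ℓ‖ ≤ s ℓ)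
    (hW' : ∀ ℓ, ‖W' ℓ‖ ≤ s ℓ) (ℓ : Fin L) :
    ‖W ℓ - W' ℓ‖ ≤ s ℓ * ‖normalizedWeights s W - normalizedWeights s W'‖ :=
  (norm_sub_le_mul_norm_inv_smul_sub (hW ℓ) (hW' ℓ)).trans <|
    mul_le_mul_of_nonneg_left
      (norm_le_pi_norm (normalizedWeights s W - normalizedWeights s W') ℓ)
      ((norm_nonneg _).trans (hW ℓ))

end Network

/-! ### The margin loss of the score -/

theorem marginLoss_eq_max_min {ρ : ℝ} (hρ : 0 < ρ) (t : ℝ) :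
    marginLoss ρ t = max 0 (min 1 (1 - t / ρ)) := by
  unfold marginLoss
  split_ifs with h1 h2
  · rw [min_eq_left, max_eq_right zero_le_one]
    linarith [div_nonpos_of_nonpos_of_nonneg h1 hρ.le]
  · have h3 : 0 < t / ρ := div_pos (not_le.1 h1) hρ
    have h4 : t / ρ < 1 := (div_lt_one hρ).2 h2
    rw [min_eq_right (by linarith), max_eq_right (by linarith)]
  · have h4 : 1 ≤ t / ρ := (one_le_div hρ).2 (not_lt.1 h2)
    rw [min_eq_right (by linarith), max_eq_left (by linarith)]

theorem abs_marginLoss_sub_le {ρ : ℝ} (hρ : 0 < ρ) (t u : ℝ) :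
    |marginLoss ρ t - marginLoss ρ u| ≤ |t - u| / ρ := by
  rw [marginLoss_eq_max_min hρ, marginLoss_eq_max_min hρ]
  rw [max_comm 0, max_comm 0, min_comm 1, min_comm 1]
  refine (abs_max_sub_max_le_abs _ _ _).trans ((abs_min_sub_min_le_max _ _ _ _).trans_eq ?_)
  rw [sub_self, abs_zero, max_eq_left (abs_nonneg _)]
  rw [show 1 - t / ρ - (1 - u / ρ) = -((t - u) / ρ) by ring, abs_neg, abs_div, abs_of_pos hρ]

theorem measurable_marginLoss {ρ : ℝ} (hρ : 0 < ρ) : Measurable (marginLoss ρ) := by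
  have : marginLoss ρ = fun t => max 0 (min 1 (1 - t / ρ)) := funext (marginLoss_eq_max_min hρ)
  rw [this]
  fun_prop

theorem abs_label (y : Label) : |(y : ℝ)| = 1 := by
  rcases y.2 with h | h
  · rw [h]; norm_num
  · rw [Set.mem_singleton_iff.1 h]; norm_num

section Score

variable {L : ℕ} {n : Fin (L + 1) → ℕ} {ψ : NetNonlin n} {𝒳 : Set (Euc (n 0))}

theorem continuous_label_mul_score (hψ : ∀ ℓ, LipschitzWith 1 (ψ ℓ)) (β : ℝ) (W : NetWeights n) :
    Continuous fun z : QPair n 𝒳 × Label => (z.2 : ℝ) * score ψ β W z.1 :=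
  (continuous_subtype_val.comp continuous_snd).mul
    (continuous_const.sub (((continuous_diffFeature hψ W).comp continuous_fst).norm.pow 2))

/-- Where the difference features are bounded by `r`, the squared norm in the score is
`2 r`-Lipschitz, so that the loss inherits the Lipschitz dependence of the encoder on its weights. -/
theorem abs_marginLoss_score_sub_le (β : ℝ) {ρ r : ℝ} (hρ : 0 < ρ) {W W' : NetWeights n}
    (z : QPair n 𝒳 × Label) (hW : ‖diffFeature ψ W z.1‖ ≤ r) (hW' : ‖diffFeature ψ W' z.1‖ ≤ r) :
    |marginLoss ρ ((z.2 : ℝ) * score ψ β W z.1) - marginLoss ρ ((z.2 : ℝ) * score ψ β W' z.1)| ≤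
      2 * r / ρ * ‖encoder ψ W z.1.1 - encoder ψ W' z.1.1‖ := by
  refine (abs_marginLoss_sub_le hρ _ _).trans ?_
  rw [← mul_sub, abs_mul, abs_label, one_mul, div_mul_eq_mul_div]
  refine div_le_div_of_nonneg_right ?_ hρ.le
  have h1 : score ψ β W z.1 - score ψ β W' z.1 =
      (‖diffFeature ψ W' z.1‖ - ‖diffFeature ψ W z.1‖)
        * (‖diffFeature ψ W' z.1‖ + ‖diffFeature ψ W z.1‖) := by
    unfold score; ring
  have h2 : |‖diffFeature ψ W' z.1‖ - ‖diffFeature ψ W z.1‖|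
      ≤ ‖encoder ψ W z.1.1 - encoder ψ W' z.1.1‖ := by
    refine (abs_norm_sub_norm_le _ _).trans_eq ?_
    rw [diffFeature, diffFeature, sub_sub_sub_cancel_right, norm_sub_rev]
  rw [h1, abs_mul, abs_of_nonneg (add_nonneg (norm_nonneg _) (norm_nonneg _)), mul_comm]
  exact mul_le_mul (by linarith) h2 (abs_nonneg _)
    (by linarith [norm_nonneg (diffFeature ψ W z.1)])

end Score

/-! ### The induced augmentation distribution -/

theorem isProbabilityMeasure_trainAugLaw {X Y : Type*} [MeasurableSpace X] [MeasurableSpace Y]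
    {M : ℕ} (P : Measure (X × Y)) [IsProbabilityMeasure P] (A : Fin M → Kernel X X)
    [∀ k, IsMarkovKernel (A k)] : IsProbabilityMeasure (trainAugLaw P A) := by
  have hA : ∀ k, IsMarkovKernel (augView A k) := by
    intro k
    refine Fin.cases ?_ (fun k => ?_) k
    · exact inferInstanceAs (IsMarkovKernel Kernel.id)
    · exact inferInstanceAs (IsMarkovKernel (A k))
  refine ⟨?_⟩
  simp only [trainAugLaw, Measure.smul_apply, Measure.finsetSum_apply, measure_univ,
    Finset.sum_const, Finset.card_univ, Fintype.card_fin, smul_eq_mul, nsmul_eq_mul, mul_one]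
  push_cast
  exact ENNReal.inv_mul_cancel (by simp) (by finiteness)

theorem mainTheorem5 {L : ℕ} (n : Fin (L + 1) → ℕ) :
    ∃ C_enc : ℝ, 0 < C_enc ∧
      ∀ (ψ : NetNonlin n), (∀ ℓ, LipschitzWith 1 (ψ ℓ)) → (∀ ℓ, ψ ℓ 0 = 0) →
      ∀ (s : Fin L → ℝ) (L_enc : ℝ), ∏ ℓ, s ℓ ≤ L_enc →
      ∀ (Θ : Set (NetWeights n)), (∀ θ ∈ Θ, ∀ ℓ, ‖θ ℓ‖ ≤ s ℓ) →
      ∀ (𝒳 : Set (Euc (n 0))), Bornology.IsBounded 𝒳 →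
      ∀ (β : ℝ)
        (P_base : Measure (QPair n 𝒳 × Label)) [IsProbabilityMeasure P_base]
        (m_base M_tr : ℕ), 0 < m_base →
      ∀ (A : Fin M_tr → Kernel (QPair n 𝒳) (QPair n 𝒳)) [∀ k, IsMarkovKernel (A k)]
        (r : ℝ),
        (∀ᵐ S ∂(trainAugSampleLaw m_base P_base A),
          ∀ (i : Fin m_base) (k : Fin (M_tr + 1)), ∀ θ ∈ Θ,
            ‖diffFeature ψ θ (S (i, k)).1‖ ≤ r) →
      ∀ (ρ δ : ℝ), 0 < ρ → 0 < δ →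
        ∃ E : Set (Fin m_base × Fin (M_tr + 1) → QPair n 𝒳 × Label),
          MeasurableSet E ∧
          1 - δ ≤ (trainAugSampleLaw m_base P_base A).real E ∧
          ∀ S ∈ E, ∀ θ ∈ Θ,
            clsRisk ψ β (trainAugLaw P_base A) θ ≤
              empMarginRisk ψ β ρ S θ
              + (2 * C_enc * inputRadius 𝒳 * L_enc / ρ)
                  * (r / Real.sqrt ((m_base : ℝ) * ((M_tr : ℝ) + 1)))
              + Real.sqrt (Real.log (1 / δ) / (2 * ((m_base : ℝ) * ((M_tr : ℝ) + 1)))) := by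
  refine ⟨12 * (3 * Module.finrank ℝ (NetWeights n) + 1) * (L + 1), by positivity, ?_⟩
  intro ψ hψ hψ0 s L_enc hL Θ hΘ 𝒳 h𝒳 β P _ m M hm A _ r hr ρ δ hρ hδ
  have hQ : IsProbabilityMeasure (trainAugLaw P A) := isProbabilityMeasure_trainAugLaw P A
  set Q := trainAugLaw P A with hQdef
  have hlaw : trainAugSampleLaw m P A = Measure.pi fun _ : Fin m × Fin (M + 1) => Q := rfl
  have hprob : IsProbabilityMeasure (trainAugSampleLaw m P A) := by rw [hlaw]; infer_instance
  -- For `δ > 1` the empty event will do, and for empty `Θ` the whole space.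
  rcases lt_or_ge 1 δ with hδ1 | hδ1
  · exact ⟨∅, MeasurableSet.empty, by simp; linarith, by simp⟩
  rcases Θ.eq_empty_or_nonempty with rfl | ⟨θ₀, hθ₀⟩
  · exact ⟨Set.univ, MeasurableSet.univ, by simp [hδ.le], by simp⟩
  have : Nonempty (Fin m) := ⟨⟨0, hm⟩⟩
  -- The set where the feature bound holds is closed and carries the augmentation distribution.
  let G : Set (QPair n 𝒳 × Label) := {z | ∀ θ ∈ Θ, ‖diffFeature ψ θ z.1‖ ≤ r}
  have hGclosed : IsClosed G := by
    simp only [G, Set.ofPred_forall]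
    exact isClosed_biInter fun θ _ => isClosed_le
      ((continuous_diffFeature hψ θ).comp continuous_fst).norm continuous_const
  have hGm : MeasurableSet G := hGclosed.measurableSet
  have hSG : ∀ᵐ S ∂(trainAugSampleLaw m P A), ∀ j, S j ∈ G := by
    filter_upwards [hr] with S hS j θ hθ using hS j.1 j.2 θ hθ
  have hQG : ∀ᵐ z ∂Q, z ∈ G := by
    have hev := measurePreserving_eval (fun _ : Fin m × Fin (M + 1) => Q) (⟨0, hm⟩, 0)
    rw [← hev.map_eq]
    refine (ae_map_iff hev.measurable.aemeasurable hGm).2 ?_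
    filter_upwards [hSG] with S hS using hS _
  obtain ⟨z₀, hz₀⟩ := hQG.exists
  have hr0 : 0 ≤ r := (norm_nonneg _).trans (hz₀ θ₀ hθ₀)
  have hs : ∀ ℓ, 0 ≤ s ℓ := fun ℓ => (norm_nonneg _).trans (hΘ θ₀ hθ₀ ℓ)
  have hp0 : 0 ≤ ∏ ℓ, s ℓ := Finset.prod_nonneg fun ℓ _ => hs ℓ
  have hbdd : BddAbove (Set.range fun q : 𝒳 => ‖(q : Euc (n 0))‖) := by
    obtain ⟨R, hR⟩ := h𝒳.exists_norm_le
    exact ⟨R, by rintro _ ⟨q, rfl⟩; exact hR q q.2⟩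
  have hq : ∀ q : 𝒳, ‖(q : Euc (n 0))‖ ≤ inputRadius 𝒳 := fun q => le_ciSup hbdd q
  have hB0 : 0 ≤ inputRadius 𝒳 := (norm_nonneg _).trans (hq z₀.1.1)
  have hL0 : 0 ≤ L_enc := hp0.trans hL
  set K := 2 * r / ρ * ((L + 1) * (L_enc * inputRadius 𝒳)) with hK
  have hK0 : 0 ≤ K := by positivity
  -- Off the null set `Gᶜ` the losses are replaced by `0`, so that they are Lipschitz everywhere.
  let f : Θ → QPair n 𝒳 × Label → ℝ := fun θ =>
    G.indicator fun z => marginLoss ρ ((z.2 : ℝ) * score ψ β θ z.1)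
  let e : Θ → NetWeights n := fun θ => normalizedWeights s θ
  have he : ∀ θ, ‖e θ‖ ≤ 1 := fun θ => norm_normalizedWeights_le_one (hΘ θ θ.2)
  have hfm : ∀ θ, Measurable (f θ) := fun θ =>
    ((measurable_marginLoss hρ).comp (continuous_label_mul_score hψ β θ).measurable).indicator hGm
  have hτ0 : ∀ t, 0 ≤ marginLoss ρ t := fun t => by
    rw [marginLoss_eq_max_min hρ]; exact le_max_left _ _
  have hτ1 : ∀ t, marginLoss ρ t ≤ 1 := fun t => by
    rw [marginLoss_eq_max_min hρ]; exact max_le zero_le_one (min_le_left _ _)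
  have hf0 : ∀ θ z, 0 ≤ f θ z := fun θ z => Set.indicator_nonneg (fun _ _ => hτ0 _) z
  have hf1 : ∀ θ z, f θ z ≤ 1 := fun θ z =>
    Set.indicator_apply_le' (fun _ => hτ1 _) fun _ => zero_le_one
  have hfK : ∀ θ θ' z, |f θ z - f θ' z| ≤ K * ‖e θ - e θ'‖ := by
    intro θ θ' z
    by_cases hz : z ∈ G
    · simp only [f, Set.indicator_of_mem hz]
      refine (abs_marginLoss_score_sub_le β hρ z (hz θ θ.2) (hz θ' θ'.2)).trans ?_
      rw [hK, mul_assoc]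
      refine mul_le_mul_of_nonneg_left ?_ (by positivity)
      refine (norm_encoder_sub_le hψ hψ0 (hΘ θ θ.2) (hΘ θ' θ'.2)
        (norm_sub_le_mul_norm_normalizedWeights_sub (hΘ θ θ.2) (hΘ θ' θ'.2)) _).trans ?_
      rw [mul_assoc (L + 1 : ℝ)]
      gcongr
      · linarith
      · exact hq _
    · simp only [f, Set.indicator_of_notMem hz, sub_self, abs_zero]
      positivity
  obtain ⟨hEm, hEδ⟩ := measurableSet_and_le_measureReal_forall_empiricalGap_le
    (ι := Fin m × Fin (M + 1)) (μ := Q) he hK0 hfm hf0 hf1 hfK hδ hδ1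
  have hcard : ((Fintype.card (Fin m × Fin (M + 1)) : ℕ) : ℝ) = (m : ℝ) * ((M : ℝ) + 1) := by
    simp
  have hGpi : MeasurableSet {S : Fin m × Fin (M + 1) → QPair n 𝒳 × Label | ∀ j, S j ∈ G} := by
    simp only [Set.ofPred_forall]
    exact MeasurableSet.iInter fun j => measurable_pi_apply j hGm
  refine ⟨_, hEm.inter hGpi, ?_, ?_⟩
  · rw [hlaw] at hSG ⊢
    refine hEδ.trans_eq (measureReal_congr ?_)
    filter_upwards [hSG] with S hS
    exact propext ⟨fun h => ⟨h, hS⟩, fun h => h.1⟩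
  · rintro S ⟨hS, hSg⟩ θ hθ
    have hgap := hS ⟨θ, hθ⟩
    have hemp : (1 / (Fintype.card (Fin m × Fin (M + 1)) : ℝ)) * ∑ j, f ⟨θ, hθ⟩ (S j)
        = empMarginRisk ψ β ρ S θ := by
      unfold empMarginRisk
      congr 1
      exact Finset.sum_congr rfl fun j _ => Set.indicator_of_mem (hSg j) _
    have hrisk : clsRisk ψ β Q θ ≤ ∫ z, f ⟨θ, hθ⟩ z ∂Q := by
      have hm0 : MeasurableSet {z : QPair n 𝒳 × Label | (z.2 : ℝ) * score ψ β θ z.1 ≤ 0} :=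
        measurableSet_le (continuous_label_mul_score hψ β θ).measurable measurable_const
      rw [clsRisk, ← integral_indicator_one hm0]
      refine integral_mono_ae ((integrable_const 1).indicator hm0)
        (Integrable.of_bound (hfm _).aestronglyMeasurable 1 (Filter.Eventually.of_forall fun z => by
          rw [Real.norm_of_nonneg (hf0 _ z)]; exact hf1 _ z)) ?_
      filter_upwards [hQG] with z hz
      refine Set.indicator_apply_le' (fun h0 => ?_) fun _ => hf0 _ z
      have h0' : (z.2 : ℝ) * score ψ β θ z.1 ≤ 0 := h0
      simp [f, Set.indicator_of_mem hz, marginLoss, h0']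
    unfold empiricalGap at hgap
    rw [hemp, hcard] at hgap
    have hconst : 12 * (3 * (Module.finrank ℝ (NetWeights n) : ℝ) + 1) * K
          / √((m : ℝ) * ((M : ℝ) + 1))
        = 2 * (12 * (3 * (Module.finrank ℝ (NetWeights n) : ℝ) + 1) * (L + 1)) * inputRadius 𝒳
          * L_enc / ρ * (r / √((m : ℝ) * ((M : ℝ) + 1))) := by
      rw [hK]; ring
    rw [hconst] at hgap
    linarith
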